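/- Let $\gamma>0$ and, on $\mathbf R^3$, let $\psi_\gamma(x)=\frac{\sqrt\gamma}{\sqrt{2\pi}}\frac{e^{-\gamma|x|}}{|x|}$ and $m(dx)=\psi_\gamma(x)^2\,dx$. Let $\mathcal F=\{u\in L^2(\mathbf R^3,m):\nabla u\in L^2(\mathbf R^3,m)\}$, where $\nabla$ is the gradient in the sense of distributions, $\mathcal E(u,v)=\frac12\int_{\mathbf R^3}\nabla u\cdot\nabla v\,dm$, and $\mathcal E_1(u,v)=\mathcal E(u,v)+\int_{\mathbf R^3} uv\,dm$ for $u,v\in\mathcal F$. For open $A\subset\mathbf R^3$ put $\mathcal L_A=\{u\in\mathcal F: u\ge 1\ m\text{-a.e. on }A\}$ and let the $1$-capacity be $\mathrm{Cap}(A)=\inf_{u\in\mathcal L_A}\mathcal E_1(u,u)$ (with $\inf\emptyset=\infty$); for arbitrary $A\subset\mathbf R^3$ let $\mathrm{Cap}(A)=\inf\{\mathrm{Cap}(B): B\supset A\text{ open}\}$. The $1$-equilibrium potential of an open set $A$ is the ($m$-a.e. unique) element $u$ of $\mathcal L_A$ with $\mathcal E_1(u,u)=\mathrm{Cap}(A)$.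 An $\mathcal E$-nest is an increasing sequence of closed sets $K_n$ such that the functions in $\mathcal F$ that vanish $m$-a.e. outside some $K_n$ are dense in $\mathcal F$ for the norm $\mathcal E_1(u,u)^{1/2}$; a set $A$ is polar if $A\subset\bigcap_n(\mathbf R^3\setminus K_n)$ for some $\mathcal E$-nest $(K_n)$. Then $\mathrm{Cap}(\{0\})>0$, and $\{0\}$ is not polar. Explicitly, let $c=\gamma-\sqrt{\gamma^2+2}$. For every $\varepsilon>0$ the $1$-equilibrium potential of $B_\varepsilon=\{x:|x|<\varepsilon\}$ exists and is the function $f_\varepsilon$ with $f_\varepsilon(x)=1$ for $|x|\le\varepsilon$ and $f_\varepsilon(x)=\exp(c(|x|-\varepsilon))$ for $|x|>\varepsilon$. Moreover $$\mathrm{Cap}(\{0\})=\frac{\gamma+\frac12\gamma c^2}{\gamma-c}.$$ -/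

import Mathlib

open MeasureTheory Set
open scoped ENNReal ContDiff

noncomputable section

namespace DistortedBM

/-- Three-dimensional Euclidean space. -/
abbrev R3 : Type := EuclideanSpace ℝ (Fin 3)

/-- The eigenfunction `ψ_γ(x) = (√γ / √(2π)) e^{-γ|x|} / |x|` (its value at `0` is irrelevant, since
it is only used as a density with respect to Lebesgue measure). -/
def psi (γ : ℝ) (x : R3) : ℝ :=
  Real.sqrt γ / Real.sqrt (2 * Real.pi) * (Real.exp (-γ * ‖x‖) / ‖x‖)

/-- The symmetrizing measure `m(dx) = ψ_γ(x)² dx`. -/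
def m (γ : ℝ) : Measure R3 :=
  volume.withDensity fun x => ENNReal.ofReal (psi γ x ^ 2)

/-- `g` is the gradient of `u` on `ℝ³` in the sense of distributions. -/
def HasWeakGradient (u : R3 → ℝ) (g : R3 → R3) : Prop :=
  LocallyIntegrable u volume ∧ LocallyIntegrable g volume ∧
    ∀ φ : R3 → ℝ, ContDiff ℝ ∞ φ → HasCompactSupport φ → ∀ w : R3,
      ∫ x, u x * fderiv ℝ φ x w = -∫ x, inner ℝ (g x) w * φ x

open Classical in
/-- The distributional gradient `∇u` (unique up to Lebesgue-null sets when it exists as a locally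
integrable function; `0` by convention otherwise). -/
def weakGradient (u : R3 → ℝ) : R3 → R3 :=
  if h : ∃ g, HasWeakGradient u g then h.choose else 0

/-- The form domain `F = {u ∈ L²(m) : ∇u ∈ L²(m)}`, as a set of functions (representatives). -/
def formDomain (γ : ℝ) : Set (R3 → ℝ) :=
  {u | MemLp u 2 (m γ) ∧ ∃ g, HasWeakGradient u g ∧ MemLp g 2 (m γ)}

/-- The energy form `E(u,v) = ½ ∫ ∇u · ∇v dm`. -/
def energy (γ : ℝ) (u v : R3 → ℝ) : ℝ :=
  1 / 2 * ∫ x, inner ℝ (weakGradient u x) (weakGradient v x) ∂(m γ)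

/-- `E₁(u,v) = E(u,v) + (u,v)_m`. -/
def energyOne (γ : ℝ) (u v : R3 → ℝ) : ℝ :=
  energy γ u v + ∫ x, u x * v x ∂(m γ)

/-- The class `{u ∈ F : u ≥ 1 m-a.e. on A}`. -/
def admissible (γ : ℝ) (A : Set R3) : Set (R3 → ℝ) :=
  {u | u ∈ formDomain γ ∧ ∀ᵐ x ∂(m γ), x ∈ A → 1 ≤ u x}

/-- The 1-capacity of an open set: the infimum of `E₁(u,u)` over the admissible functions
(`∞` if there are none). -/
def openCap (γ : ℝ) (A : Set R3) : ℝ≥0∞ :=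
  ⨅ u ∈ admissible γ A, ENNReal.ofReal (energyOne γ u u)

/-- The 1-capacity of an arbitrary set: the infimum of the capacities of its open supersets. -/
def cap (γ : ℝ) (A : Set R3) : ℝ≥0∞ :=
  ⨅ (B : Set R3) (_ : IsOpen B) (_ : A ⊆ B), openCap γ B

/-- `f` is the 1-equilibrium potential of the open set `A`: the element of `{u ∈ F : u ≥ 1 m-a.e.
on A}`, unique up to `m`-null sets, at which the capacity of `A` is attained. -/
def IsEquilibriumPotential (γ : ℝ) (A : Set R3) (f : R3 → ℝ) : Prop :=
  f ∈ admissible γ A ∧ ENNReal.ofReal (energyOne γ f f) = cap γ A ∧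
    ∀ u ∈ admissible γ A, ENNReal.ofReal (energyOne γ u u) = cap γ A → u =ᵐ[m γ] f

/-- An `E`-nest: an increasing sequence of closed sets `K n` such that the functions of `F` that
vanish `m`-a.e. outside some `K n` are `E₁`-dense in `F`. -/
def IsNest (γ : ℝ) (K : ℕ → Set R3) : Prop :=
  (∀ n, IsClosed (K n)) ∧ Monotone K ∧
    ∀ u ∈ formDomain γ, ∀ δ : ℝ, 0 < δ → ∃ n, ∃ v ∈ formDomain γ,
      (∀ᵐ x ∂(m γ), x ∉ K n → v x = 0) ∧ energyOne γ (u - v) (u - v) < δ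

/-- `A` is polar with respect to `(E, F)`: some `E`-nest has no member that meets `A`. -/
def IsPolar (γ : ℝ) (A : Set R3) : Prop :=
  ∃ K : ℕ → Set R3, IsNest γ K ∧ A ⊆ ⋂ n, (K n)ᶜ

/-- The exponent `c = γ - √(γ² + 2)`. -/
def expo (γ : ℝ) : ℝ := γ - Real.sqrt (γ ^ 2 + 2)

open Classical in
/-- The function equal to `1` where `|x| ≤ ε` and to `exp (c (|x| - ε))` elsewhere. -/
def potential (γ ε : ℝ) (x : R3) : ℝ :=
  if ‖x‖ ≤ ε then 1 else Real.exp (expo γ * (‖x‖ - ε))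

end DistortedBM

end

noncomputable section

namespace DistortedBM

/-! The factor `|x|⁻²` in `ψ_γ²` cancels the Jacobian `r²`, so radial functions live on a half-line
with weight `2γ e^{-2γr}`, for which the origin is an end point at finite distance, as in dimension
one. Off the ball, minimality forces the radial equation `f'' - 2γ f' = 2f`; its decaying
exponential solution has exponent `c`, the negative root of `c² - 2γc = 2`.

The core is the variational inequality `E₁(f_ε, v) ≥ 0` for every `v ∈ F` that is nonnegative on the
ball (`energyOne_potential_nonneg`). Formally, integration by parts leaves on the sphere a term
`-f_ε'(ε+) v` with `f_ε'(ε+) = c < 0`, while inside only `∫ v dm` remains. Traces of `v` are avoided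
by a smooth cutoff whose ramp lies inside the ball (`cutoff_inequality`), followed by a limit
(`tendsto_cutoff_integral`).

With `v = u - f_ε`, expanding the square yields both minimality and uniqueness (`energyOne_add_le`).
The energy of `f_ε` is explicit (`energyOne_potential`), bounded below by its limit as `ε → 0`,
which is thus the capacity of the origin. A nest avoiding `0` would produce functions equal to `1`
near `0` with energy below that positive value. -/

/-! ### The measure `m` and its radial integrals. -/

lemma measurable_psi (γ : ℝ) : Measurable (psi γ) := by
  unfold psi; fun_prop

lemma psi_sq {γ : ℝ} (hγ : 0 < γ) (x : R3) :
    psi γ x ^ 2 = γ / (2 * Real.pi) * Real.exp (-2 * γ * ‖x‖) / ‖x‖ ^ 2 := by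
  unfold psi
  rw [mul_pow, div_pow, div_pow, Real.sq_sqrt hγ.le, Real.sq_sqrt (by positivity),
    ← Real.exp_nat_mul, mul_div_assoc, Nat.cast_ofNat, neg_mul, mul_neg, neg_mul, neg_mul,
    mul_assoc 2]

lemma m_absolutelyContinuous (γ : ℝ) : m γ ≪ volume := withDensity_absolutelyContinuous _ _

lemma ae_ne_zero : ∀ᵐ x : R3, x ≠ 0 := by
  simp [ae_iff]

lemma psi_sq_pos {γ : ℝ} (hγ : 0 < γ) {x : R3} (hx : x ≠ 0) : 0 < psi γ x ^ 2 := by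
  have := norm_pos_iff.2 hx
  rw [psi_sq hγ]
  positivity

lemma volume_absolutelyContinuous_m {γ : ℝ} (hγ : 0 < γ) : (volume : Measure R3) ≪ m γ := by
  refine withDensity_absolutelyContinuous' ?_ ?_
  · exact ((measurable_psi γ).pow_const 2).ennreal_ofReal.aemeasurable
  · filter_upwards [ae_ne_zero] with x hx
    exact (ENNReal.ofReal_pos.2 (psi_sq_pos hγ hx)).ne'

lemma integral_m (γ : ℝ) (F : R3 → ℝ) : ∫ x, F x ∂(m γ) = ∫ x, psi γ x ^ 2 * F x := by
  unfold m
  rw [integral_withDensity_eq_integral_toReal_smul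
    ((measurable_psi γ).pow_const 2).ennreal_ofReal (by simp)]
  simp [ENNReal.toReal_ofReal (sq_nonneg _)]

lemma integrable_psi_sq {γ : ℝ} (hγ : 0 < γ) : Integrable (fun x => psi γ x ^ 2) := by
  simp_rw [psi_sq hγ]
  rw [integrable_fun_norm_addHaar (volume : Measure R3)
    (f := fun r => γ / (2 * Real.pi) * Real.exp (-2 * γ * r) / r ^ 2)]
  have : IntegrableOn (fun r => γ / (2 * Real.pi) * Real.exp ((-2 * γ) * r)) (Ioi 0) :=
    (integrableOn_exp_mul_Ioi (by linarith) 0).const_mul _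
  refine this.congr_fun (fun r hr => ?_) measurableSet_Ioi
  have : r ≠ 0 := (mem_Ioi.1 hr).ne'
  simp only [finrank_euclideanSpace, Fintype.card_fin, smul_eq_mul]
  field_simp

lemma isFiniteMeasure_m {γ : ℝ} (hγ : 0 < γ) : IsFiniteMeasure (m γ) :=
  isFiniteMeasure_withDensity_ofReal (integrable_psi_sq hγ).2

/-- In polar coordinates `r²` cancels, and the constant is `3 · vol(B₁) · γ/(2π) = 2γ`. Thus `|x|`
is exponentially distributed with rate `2γ` under `m`. -/
lemma integral_norm_m {γ : ℝ} (hγ : 0 < γ) (F : ℝ → ℝ) :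
    ∫ x, F ‖x‖ ∂(m γ) = 2 * γ * ∫ r in Ioi 0, Real.exp (-2 * γ * r) * F r := by
  rw [integral_m]
  simp_rw [psi_sq hγ]
  rw [integral_fun_norm_addHaar (volume : Measure R3)
    (f := fun r => γ / (2 * Real.pi) * Real.exp (-2 * γ * r) / r ^ 2 * F r)]
  have : ∫ r in Ioi (0 : ℝ), r ^ (Module.finrank ℝ R3 - 1) •
      (γ / (2 * Real.pi) * Real.exp (-2 * γ * r) / r ^ 2 * F r)
      = ∫ r in Ioi (0 : ℝ), γ / (2 * Real.pi) * (Real.exp (-2 * γ * r) * F r) := by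
    refine setIntegral_congr_fun measurableSet_Ioi fun r hr => ?_
    have : r ≠ 0 := (mem_Ioi.1 hr).ne'
    simp only [finrank_euclideanSpace, Fintype.card_fin, smul_eq_mul]
    field_simp
  rw [this, integral_const_mul, measureReal_def, EuclideanSpace.volume_ball_fin_three]
  simp only [finrank_euclideanSpace, Fintype.card_fin, smul_eq_mul, nsmul_eq_mul]
  have := Real.pi_pos
  rw [ENNReal.toReal_mul, ENNReal.toReal_ofReal (by positivity)]
  simp
  field_simp
  norm_num

/-! ### Distributional gradients and the quadratic form. -/

lemma HasWeakGradient.sub {u v : R3 → ℝ} {g h : R3 → R3} (hu : HasWeakGradient u g)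
    (hv : HasWeakGradient v h) : HasWeakGradient (u - v) (g - h) := by
  refine ⟨hu.1.sub hv.1, hu.2.1.sub hv.2.1, fun φ hφ hc w => ?_⟩
  have hd : Continuous fun x => fderiv ℝ φ x w :=
    (hφ.continuous_fderiv (by simp)).clm_apply continuous_const
  have hdc : HasCompactSupport fun x => fderiv ℝ φ x w := hc.fderiv_apply ℝ w
  have aux : ∀ {a : R3 → ℝ}, LocallyIntegrable a volume →
      Integrable fun x => a x * fderiv ℝ φ x w := fun ha => by
    simpa [mul_comm] using ha.integrable_smul_left_of_hasCompactSupport hd hdc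
  have aux' : ∀ {a : R3 → R3}, LocallyIntegrable a volume →
      Integrable fun x => inner ℝ (a x) w * φ x := fun ha => by
    have := (ha.integrable_smul_left_of_hasCompactSupport hφ.continuous hc).inner_const (𝕜 := ℝ) w
    simpa [inner_smul_left, mul_comm] using this
  have h1 : ∀ x, (u - v) x * fderiv ℝ φ x w = u x * fderiv ℝ φ x w - v x * fderiv ℝ φ x w :=
    fun x => by simp [sub_mul]
  have h2 : ∀ x, inner ℝ ((g - h) x) w * φ x = inner ℝ (g x) w * φ x - inner ℝ (h x) w * φ x :=
    fun x => by simp [sub_mul, inner_sub_left]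
  simp_rw [h1, h2]
  rw [integral_sub (aux hu.1) (aux hv.1), integral_sub (aux' hu.2.1) (aux' hv.2.1),
    hu.2.2 φ hφ hc w, hv.2.2 φ hφ hc w]
  ring

/-- The fundamental lemma of the calculus of variations, tested componentwise. It makes the chosen
`weakGradient` computable from any explicit gradient. -/
lemma HasWeakGradient.ae_eq {u : R3 → ℝ} {g h : R3 → R3} (hg : HasWeakGradient u g)
    (hh : HasWeakGradient u h) : g =ᵐ[volume] h := by
  refine ae_eq_of_integral_contDiff_smul_eq hg.2.1 hh.2.1 fun φ hφ hc => ?_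
  refine ext_inner_right ℝ fun w => ?_
  have aux : ∀ {a : R3 → R3}, LocallyIntegrable a volume →
      inner ℝ (∫ x, φ x • a x) w = ∫ x, inner ℝ (a x) w * φ x := fun ha => by
    rw [real_inner_comm, ← integral_inner
      (ha.integrable_smul_left_of_hasCompactSupport hφ.continuous hc)]
    simp [inner_smul_right, mul_comm, real_inner_comm]
  rw [aux hg.2.1, aux hh.2.1, ← neg_inj, ← hg.2.2 φ hφ hc w, hh.2.2 φ hφ hc w]

lemma HasWeakGradient.weakGradient_ae_eq {u : R3 → ℝ} {g : R3 → R3} (hg : HasWeakGradient u g) :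
    weakGradient u =ᵐ[volume] g := by
  have h : ∃ g, HasWeakGradient u g := ⟨g, hg⟩
  rw [weakGradient, dif_pos h]
  exact h.choose_spec.ae_eq hg

lemma hasWeakGradient_weakGradient {γ : ℝ} {u : R3 → ℝ} (hu : u ∈ formDomain γ) :
    HasWeakGradient u (weakGradient u) := by
  obtain ⟨-, g, hg, -⟩ := hu
  have h : ∃ g, HasWeakGradient u g := ⟨g, hg⟩
  rw [weakGradient, dif_pos h]
  exact h.choose_spec

lemma memLp_weakGradient {γ : ℝ} {u : R3 → ℝ} (hu : u ∈ formDomain γ) :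
    MemLp (weakGradient u) 2 (m γ) := by
  obtain ⟨-, g, hg, hg2⟩ := hu
  exact hg2.ae_eq ((m_absolutelyContinuous γ).ae_eq hg.weakGradient_ae_eq.symm)

lemma sub_mem_formDomain {γ : ℝ} {u v : R3 → ℝ} (hu : u ∈ formDomain γ) (hv : v ∈ formDomain γ) :
    u - v ∈ formDomain γ := by
  obtain ⟨hu, g, hg, hg2⟩ := hu
  obtain ⟨hv, h, hh, hh2⟩ := hv
  exact ⟨hu.sub hv, g - h, hg.sub hh, hg2.sub hh2⟩

lemma weakGradient_sub {γ : ℝ} {u v : R3 → ℝ} (hu : u ∈ formDomain γ) (hv : v ∈ formDomain γ) :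
    weakGradient (u - v) =ᵐ[m γ] weakGradient u - weakGradient v :=
  (m_absolutelyContinuous γ).ae_eq ((hasWeakGradient_weakGradient hu).sub
    (hasWeakGradient_weakGradient hv)).weakGradient_ae_eq

lemma MemLp.integrable_inner {α : Type*} [MeasurableSpace α] {μ : Measure α} {f g : α → R3}
    (hf : MemLp f 2 μ) (hg : MemLp g 2 μ) : Integrable (fun x => inner ℝ (f x) (g x)) μ := by
  refine (L2.integrable_inner (𝕜 := ℝ) (hf.toLp f) (hg.toLp g)).congr ?_
  filter_upwards [hf.coeFn_toLp, hg.coeFn_toLp] with x h1 h2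
  rw [h1, h2]

/-- Expansion of the energy of `u = f + (u - f)`. -/
lemma energyOne_eq_add {γ : ℝ} {u f : R3 → ℝ} (hu : u ∈ formDomain γ) (hf : f ∈ formDomain γ) :
    energyOne γ u u = energyOne γ f f + 2 * energyOne γ f (u - f)
      + energyOne γ (u - f) (u - f) := by
  have hv := sub_mem_formDomain hu hf
  have gf := memLp_weakGradient hf
  have gv := memLp_weakGradient hv
  have e1 : ∫ x, inner ℝ (weakGradient u x) (weakGradient u x) ∂(m γ)
      = ∫ x, (inner ℝ (weakGradient f x) (weakGradient f x)
        + 2 * inner ℝ (weakGradient f x) (weakGradient (u - f) x))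
        + inner ℝ (weakGradient (u - f) x) (weakGradient (u - f) x) ∂(m γ) := by
    refine integral_congr_ae ?_
    filter_upwards [weakGradient_sub hu hf] with x hx
    rw [hx]
    simp only [Pi.sub_apply, inner_sub_left, inner_sub_right,
      real_inner_comm (weakGradient f x) (weakGradient u x)]
    ring
  have e2 : ∫ x, u x * u x ∂(m γ) = ∫ x, (f x * f x + 2 * (f x * (u - f) x))
        + (u - f) x * (u - f) x ∂(m γ) := by
    congr 1 with x
    simp only [Pi.sub_apply]
    ring
  have i1 := MemLp.integrable_inner gf gf
  have i2 := (MemLp.integrable_inner gf gv).const_mul 2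
  have i3 := MemLp.integrable_inner gv gv
  have j1 : Integrable (fun x => f x * f x) (m γ) := hf.1.integrable_mul hf.1
  have j2 : Integrable (fun x => 2 * (f x * (u - f) x)) (m γ) := (hf.1.integrable_mul hv.1).const_mul 2
  have j3 : Integrable (fun x => (u - f) x * (u - f) x) (m γ) := hv.1.integrable_mul hv.1
  unfold energyOne energy
  rw [e1, e2, integral_add (by exact i1.add i2) i3, integral_add i1 i2, integral_const_mul,
    integral_add (by exact j1.add j2) j3, integral_add j1 j2, integral_const_mul]
  ring

lemma integral_sq_le_energyOne (γ : ℝ) (u : R3 → ℝ) :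
    ∫ x, u x * u x ∂(m γ) ≤ energyOne γ u u := by
  have : 0 ≤ energy γ u u :=
    mul_nonneg (by norm_num) (integral_nonneg fun x => real_inner_self_nonneg)
  unfold energyOne
  linarith

/-! ### Integration by parts against radial fields. -/

lemma contDiff_comp_norm {K : ℝ → ℝ} {a : ℝ} (hK : ∀ r, 0 < r → ContDiffAt ℝ ∞ K r) (ha : 0 < a)
    (h0 : ∀ r < a, K r = 0) : ContDiff ℝ ∞ fun x : R3 => K ‖x‖ := by
  rw [contDiff_iff_contDiffAt]
  intro x
  rcases eq_or_ne x 0 with rfl | hx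
  · refine (contDiffAt_const (c := (0 : ℝ))).congr_of_eventuallyEq ?_
    filter_upwards [Metric.ball_mem_nhds (0 : R3) ha] with y hy
    exact h0 _ (by simpa using hy)
  · exact (hK _ (norm_pos_iff.2 hx)).comp x (contDiffAt_norm ℝ hx)

lemma hasFDerivAt_comp_norm {K : ℝ → ℝ} {x : R3} (hx : x ≠ 0) (hK : DifferentiableAt ℝ K ‖x‖) :
    HasFDerivAt (fun x : R3 => K ‖x‖) ((deriv K ‖x‖ / ‖x‖) • innerSL ℝ x) x := by
  have hn : 0 < ‖x‖ := norm_pos_iff.2 hx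
  have h1 : HasFDerivAt (fun x : R3 => ‖x‖) ((1 / ‖x‖) • innerSL ℝ x) x := by
    have := ((hasStrictFDerivAt_norm_sq x).hasFDerivAt).sqrt (pow_pos hn 2).ne'
    simp only [Real.sqrt_sq (norm_nonneg _)] at this
    refine this.congr_fderiv ?_
    ext w
    simp
    field_simp
  have := hK.hasDerivAt.comp_hasFDerivAt x h1
  refine this.congr_fderiv ?_
  rw [smul_smul, mul_one_div]

/-- Integration by parts of a weakly differentiable function against a radial field. -/
lemma HasWeakGradient.integral_radial {v : R3 → ℝ} {g : R3 → R3} (hv : HasWeakGradient v g)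
    {K : ℝ → ℝ} {a b : ℝ} (hK : ∀ r, 0 < r → ContDiffAt ℝ ∞ K r) (ha : 0 < a)
    (h0 : ∀ r < a, K r = 0) (h1 : ∀ r, b < r → K r = 0) :
    Integrable (fun x => v x * (‖x‖ * deriv K ‖x‖ + 3 * K ‖x‖)) ∧
      Integrable (fun x => inner ℝ (g x) x * K ‖x‖) ∧
      ∫ x, v x * (‖x‖ * deriv K ‖x‖ + 3 * K ‖x‖) = -∫ x, inner ℝ (g x) x * K ‖x‖ := by
  have hKs := contDiff_comp_norm hK ha h0
  have hKc : HasCompactSupport fun x : R3 => K ‖x‖ := by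
    refine HasCompactSupport.intro (isCompact_closedBall 0 b) fun x hx => h1 _ ?_
    simpa using hx
  -- The components `K(|x|) xᵢ` of the field `K(|x|) x` serve as test functions in the directions
  -- `eᵢ`; summing over `i` produces its divergence `r K' + 3K`.
  let e := EuclideanSpace.basisFun (Fin 3) ℝ
  have hφ : ∀ i : Fin 3, ContDiff ℝ ∞ fun x : R3 => K ‖x‖ * x i := fun i =>
    hKs.mul (EuclideanSpace.proj (𝕜 := ℝ) i).contDiff
  have hc : ∀ i : Fin 3, HasCompactSupport fun x : R3 => K ‖x‖ * x i := fun i => hKc.mul_right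
  have key := fun i => hv.2.2 _ (hφ i) (hc i) (e i)
  have hdiv : ∀ᵐ x : R3, v x * (‖x‖ * deriv K ‖x‖ + 3 * K ‖x‖)
      = ∑ i, v x * fderiv ℝ (fun x : R3 => K ‖x‖ * x i) x (e i) := by
    filter_upwards [ae_ne_zero] with x hx
    have hn : 0 < ‖x‖ := norm_pos_iff.2 hx
    have hd := hasFDerivAt_comp_norm hx ((hK _ hn).differentiableAt (by simp))
    have : ∀ i : Fin 3, fderiv ℝ (fun x : R3 => K ‖x‖ * x i) x (e i)
        = K ‖x‖ + x i * (deriv K ‖x‖ / ‖x‖ * x i) := fun i => by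
      have hm : HasFDerivAt (fun x : R3 => K ‖x‖ * x i) _ x :=
        hd.mul (EuclideanSpace.proj (𝕜 := ℝ) i).hasFDerivAt
      rw [hm.fderiv]
      simp [e, EuclideanSpace.inner_single_right]
    simp_rw [this]
    rw [← Finset.mul_sum, Finset.sum_add_distrib]
    have hs : ∑ i, x i * (deriv K ‖x‖ / ‖x‖ * x i) = deriv K ‖x‖ / ‖x‖ * ‖x‖ ^ 2 := by
      rw [EuclideanSpace.real_norm_sq_eq, Finset.mul_sum]
      exact Finset.sum_congr rfl fun i _ => by ring
    rw [hs]
    simp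
    field_simp
    left
    ring
  have hinner : ∀ x, inner ℝ (g x) x * K ‖x‖ = ∑ i, inner ℝ (g x) (e i) * (K ‖x‖ * x i) := by
    intro x
    simp only [PiLp.inner_apply, e, EuclideanSpace.basisFun_apply, Finset.sum_mul]
    refine Finset.sum_congr rfl fun i _ => ?_
    simp
    ring
  have i1 : ∀ i, Integrable fun x => v x * fderiv ℝ (fun x : R3 => K ‖x‖ * x i) x (e i) := by
    intro i
    have hd : Continuous fun x => fderiv ℝ (fun x : R3 => K ‖x‖ * x i) x (e i) :=
      ((hφ i).continuous_fderiv (by simp)).clm_apply continuous_const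
    simpa [mul_comm] using
      hv.1.integrable_smul_left_of_hasCompactSupport hd ((hc i).fderiv_apply ℝ (e i))
  have i2 : ∀ i, Integrable fun x => inner ℝ (g x) (e i) * (K ‖x‖ * x i) := by
    intro i
    have := (hv.2.1.integrable_smul_left_of_hasCompactSupport (hφ i).continuous
      (hc i)).inner_const (𝕜 := ℝ) (e i)
    simp_rw [inner_smul_left] at this
    simpa [mul_comm] using this
  simp_rw [hinner]
  refine ⟨(integrable_finsetSum _ fun i _ => i1 i).congr (hdiv.mono fun x hx => hx.symm),
    integrable_finsetSum _ fun i _ => i2 i, ?_⟩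
  rw [integral_congr_ae hdiv, integral_finsetSum _ fun i _ => i1 i]
  rw [integral_finsetSum _ fun i _ => i2 i, ← Finset.sum_neg_distrib]
  exact Finset.sum_congr rfl fun i _ => key i

/-! ### The candidate potential and its gradient. -/

lemma expo_neg (γ : ℝ) : expo γ < 0 := by
  have : γ < Real.sqrt (γ ^ 2 + 2) := Real.lt_sqrt_of_sq_lt (by linarith)
  unfold expo
  linarith

lemma expo_mul_sub (γ : ℝ) : expo γ * (expo γ - 2 * γ) = 2 := by
  have := Real.sq_sqrt (show 0 ≤ γ ^ 2 + 2 by positivity)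
  unfold expo
  linear_combination this

/-- The gradient of `potential γ ε` off the sphere of radius `ε`. -/
def potentialGrad (γ ε : ℝ) (x : R3) : R3 :=
  (Ioi ε).indicator (fun r => expo γ * Real.exp (expo γ * (r - ε)) / r) ‖x‖ • x

lemma potential_eq (γ ε : ℝ) (x : R3) :
    potential γ ε x = Real.exp (expo γ * (max ‖x‖ ε - ε)) := by
  unfold potential
  split_ifs with h
  · simp [max_eq_right h]
  · rw [max_eq_left (not_le.1 h).le]

lemma abs_potential_le (γ ε : ℝ) (x : R3) : ‖potential γ ε x‖ ≤ 1 := by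
  rw [potential_eq, Real.norm_eq_abs, Real.abs_exp, Real.exp_le_one_iff]
  exact mul_nonpos_of_nonpos_of_nonneg (expo_neg γ).le (sub_nonneg.2 (le_max_right _ _))

/-- Written through `max ‖x‖ ε`, the potential is a Lipschitz function on `[ε, ∞)` composed with a
1-Lipschitz map. Lipschitz regularity lets its almost everywhere derivative serve as distributional
gradient despite the kink on the sphere. -/
lemma lipschitzWith_potential (γ ε : ℝ) :
    LipschitzWith (Real.nnabs (expo γ)) (potential γ ε) := by
  have h1 : LipschitzOnWith (Real.nnabs (expo γ)) (fun r => Real.exp (expo γ * (r - ε)))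
      (Ici ε) := by
    have hd : ∀ r, HasDerivAt (fun r => Real.exp (expo γ * (r - ε)))
        (Real.exp (expo γ * (r - ε)) * expo γ) r := fun r => by
      simpa using (((hasDerivAt_id r).sub_const ε).const_mul (expo γ)).exp
    refine (convex_Ici ε).lipschitzOnWith_of_nnnorm_deriv_le
      (fun r _ => (hd r).differentiableAt) fun r hr => ?_
    rw [(hd r).deriv, ← NNReal.coe_le_coe]
    have : Real.exp (expo γ * (r - ε)) ≤ 1 := Real.exp_le_one_iff.2
      (mul_nonpos_of_nonpos_of_nonneg (expo_neg γ).le (sub_nonneg.2 hr))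
    simpa using mul_le_mul_of_nonneg_right this (abs_nonneg (expo γ))
  have h2 : LipschitzWith 1 fun x : R3 => max ‖x‖ ε := lipschitzWith_one_norm.max_const ε
  have h3 := h1.comp h2.lipschitzOnWith (s := univ) fun x _ => le_max_right ‖x‖ ε
  rw [mul_one, lipschitzOnWith_univ] at h3
  convert h3 using 1
  ext x
  exact potential_eq γ ε x

lemma ae_norm_ne (ε : ℝ) : ∀ᵐ x : R3, ‖x‖ ≠ ε := by
  have := Measure.addHaar_sphere (volume : Measure R3) 0 ε
  rw [ae_iff]
  simpa [Metric.sphere, dist_zero_right] using this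

lemma hasFDerivAt_potential (γ : ℝ) {ε : ℝ} (hε : 0 < ε) {x : R3} (hx : ‖x‖ ≠ ε) :
    HasFDerivAt (potential γ ε) (innerSL ℝ (potentialGrad γ ε x)) x := by
  rcases lt_or_gt_of_ne hx with h | h
  · have : potentialGrad γ ε x = 0 := by
      simp [potentialGrad, h.le]
    rw [this, map_zero]
    refine (hasFDerivAt_const (1 : ℝ) x).congr_of_eventuallyEq ?_
    filter_upwards [(isOpen_lt continuous_norm continuous_const).mem_nhds h] with y hy
    exact if_pos (le_of_lt hy)
  · have hn : x ≠ 0 := norm_pos_iff.1 (hε.trans h)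
    have hd : HasDerivAt (fun r => Real.exp (expo γ * (r - ε)))
        (Real.exp (expo γ * (‖x‖ - ε)) * expo γ) ‖x‖ := by
      simpa using (((hasDerivAt_id ‖x‖).sub_const ε).const_mul (expo γ)).exp
    have := hasFDerivAt_comp_norm hn hd.differentiableAt
    rw [hd.deriv] at this
    have hg : potentialGrad γ ε x = (Real.exp (expo γ * (‖x‖ - ε)) * expo γ / ‖x‖) • x := by
      simp [potentialGrad, h, mul_comm]
    rw [hg, map_smul]
    refine this.congr_of_eventuallyEq ?_
    filter_upwards [(isOpen_lt continuous_const continuous_norm).mem_nhds h] with y hy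
    exact if_neg (not_le.2 hy)

lemma measurable_potentialGrad (γ ε : ℝ) : Measurable (potentialGrad γ ε) := by
  unfold potentialGrad
  have : Measurable ((Ioi ε).indicator fun r => expo γ * Real.exp (expo γ * (r - ε)) / r) :=
    Measurable.indicator (by fun_prop) measurableSet_Ioi
  exact (this.comp measurable_norm).smul measurable_id

lemma norm_potentialGrad_le (γ : ℝ) {ε : ℝ} (hε : 0 < ε) (x : R3) :
    ‖potentialGrad γ ε x‖ ≤ |expo γ| := by
  unfold potentialGrad
  by_cases h : ε < ‖x‖
  · have hn := hε.trans h
    rw [indicator_of_mem (mem_Ioi.2 h), norm_smul, Real.norm_eq_abs, abs_div, abs_mul,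
      abs_of_pos hn, Real.abs_exp, div_mul_cancel₀ _ hn.ne']
    refine mul_le_of_le_one_right (abs_nonneg _) (Real.exp_le_one_iff.2 ?_)
    exact mul_nonpos_of_nonpos_of_nonneg (expo_neg γ).le (sub_nonneg.2 h.le)
  · rw [indicator_of_notMem (by simpa using h), zero_smul, norm_zero]
    exact abs_nonneg _

lemma hasWeakGradient_potential (γ : ℝ) {ε : ℝ} (hε : 0 < ε) :
    HasWeakGradient (potential γ ε) (potentialGrad γ ε) := by
  refine ⟨(lipschitzWith_potential γ ε).continuous.locallyIntegrable, ?_, fun φ hφ hc w => ?_⟩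
  · exact (locallyIntegrable_const |expo γ|).mono
      (measurable_potentialGrad γ ε).aestronglyMeasurable
      (.of_forall fun x => (norm_potentialGrad_le γ hε x).trans (le_abs_self _))
  · obtain ⟨C, hC⟩ := ContDiff.lipschitzWith_of_hasCompactSupport hc hφ (by simp)
    have := (lipschitzWith_potential γ ε).integral_lineDeriv_mul_eq (μ := volume) hC hc w
    have e1 : ∫ x, lineDeriv ℝ (potential γ ε) x w * φ x
        = ∫ x, inner ℝ (potentialGrad γ ε x) w * φ x := by
      refine integral_congr_ae ?_
      filter_upwards [ae_norm_ne ε] with x hx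
      rw [((hasFDerivAt_potential γ hε hx).hasLineDerivAt w).lineDeriv, innerSL_apply_apply]
    rw [← e1, this, ← integral_neg]
    congr 1 with x
    rw [((hφ.differentiable (by simp)) x).lineDeriv_eq_fderiv, map_neg]
    ring

lemma potential_mem_formDomain {γ ε : ℝ} (hγ : 0 < γ) (hε : 0 < ε) :
    potential γ ε ∈ formDomain γ := by
  have := isFiniteMeasure_m hγ
  refine ⟨?_, _, hasWeakGradient_potential γ hε, ?_⟩
  · exact MemLp.of_bound (lipschitzWith_potential γ ε).continuous.aestronglyMeasurable 1
      (.of_forall (abs_potential_le γ ε))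
  · exact MemLp.of_bound (measurable_potentialGrad γ ε).aestronglyMeasurable _
      (.of_forall (norm_potentialGrad_le γ hε))

lemma weakGradient_potential (γ : ℝ) {ε : ℝ} (hε : 0 < ε) :
    weakGradient (potential γ ε) =ᵐ[m γ] potentialGrad γ ε :=
  (m_absolutelyContinuous γ).ae_eq (hasWeakGradient_potential γ hε).weakGradient_ae_eq

/-! ### Smooth cutoffs and the variational inequality. -/

open Real.smoothTransition in
-- Such points are global extrema, which covers the end points `0` and `1` as well.
lemma deriv_smoothTransition_eq_zero {s : ℝ} (hs : s ≤ 0 ∨ 1 ≤ s) :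
    deriv Real.smoothTransition s = 0 := by
  rcases hs with hs | hs
  · refine IsLocalMin.deriv_eq_zero (.of_forall fun y => ?_)
    rw [zero_of_nonpos hs]
    exact nonneg y
  · refine IsLocalMax.deriv_eq_zero (.of_forall fun y => ?_)
    rw [one_of_one_le hs]
    exact le_one y

lemma continuous_deriv_smoothTransition : Continuous (deriv Real.smoothTransition) :=
  (Real.smoothTransition.contDiff (n := 1)).continuous_deriv (by simp)

lemma exists_abs_deriv_smoothTransition_le : ∃ C, ∀ s, |deriv Real.smoothTransition s| ≤ C := by
  have hc : HasCompactSupport (deriv Real.smoothTransition) := by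
    refine HasCompactSupport.intro (isCompact_Icc (a := (0 : ℝ)) (b := 1)) fun s hs => ?_
    refine deriv_smoothTransition_eq_zero ?_
    by_contra! h
    exact hs ⟨h.1.le, h.2.le⟩
  exact continuous_deriv_smoothTransition.bounded_above_of_compact_support hc

/-- A smooth cutoff, equal to `1` on `[ε, t]` and to `0` outside `[ε - 1/t, t + 1]`. -/
def cutoff (ε t r : ℝ) : ℝ :=
  Real.smoothTransition (t * (r - ε) + 1) * Real.smoothTransition (t + 1 - r)

lemma hasDerivAt_smoothTransition (s : ℝ) :
    HasDerivAt Real.smoothTransition (deriv Real.smoothTransition s) s :=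
  ((Real.smoothTransition.contDiff (n := 1)).differentiable (by simp) s).hasDerivAt

lemma hasDerivAt_cutoff (ε t r : ℝ) :
    HasDerivAt (cutoff ε t) (t * deriv Real.smoothTransition (t * (r - ε) + 1) *
      Real.smoothTransition (t + 1 - r) - Real.smoothTransition (t * (r - ε) + 1) *
        deriv Real.smoothTransition (t + 1 - r)) r := by
  have h1 : HasDerivAt (fun r => t * (r - ε) + 1) t r := by
    simpa using (((hasDerivAt_id r).sub_const ε).const_mul t).add_const 1
  have h2 : HasDerivAt (fun r => t + 1 - r) (-1) r := by
    simpa using (hasDerivAt_id r).const_sub (t + 1)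
  have := ((hasDerivAt_smoothTransition _).comp r h1).mul
    ((hasDerivAt_smoothTransition _).comp r h2)
  refine this.congr_deriv ?_
  simp only [Function.comp_apply]
  ring

lemma contDiff_cutoff (ε t : ℝ) : ContDiff ℝ ∞ (cutoff ε t) := by
  have h := Real.smoothTransition.contDiff (n := ⊤)
  exact (h.comp (by fun_prop : ContDiff ℝ ∞ fun r : ℝ => t * (r - ε) + 1)).mul
    (h.comp (by fun_prop : ContDiff ℝ ∞ fun r : ℝ => t + 1 - r))

lemma cutoff_nonneg (ε t r : ℝ) : 0 ≤ cutoff ε t r :=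
  mul_nonneg (Real.smoothTransition.nonneg _) (Real.smoothTransition.nonneg _)

lemma cutoff_le_one (ε t r : ℝ) : cutoff ε t r ≤ 1 :=
  mul_le_one₀ (Real.smoothTransition.le_one _) (Real.smoothTransition.nonneg _)
    (Real.smoothTransition.le_one _)

/-- The field `ψ² ∇f`, with `f = e^{c(|x|-ε)}`, has divergence `2ψ² f` off the origin. Multiplying
it by the cutoff adds two terms: the outer ramp is kept in the integrand, while the inner one, of
size `t`, lives where `v ≥ 0` and is discarded by sign. The bound `1 < t * ε` keeps the support away
from the origin. -/
lemma cutoff_inequality {γ ε t : ℝ} (hγ : 0 < γ) (ht : 0 < t) (htε : 1 < t * ε)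
    {v : R3 → ℝ} {g : R3 → R3} (hv : HasWeakGradient v g)
    (hpos : ∀ᵐ x, ‖x‖ < ε → 0 ≤ v x) :
    0 ≤ ∫ x, (inner ℝ (g x) x / ‖x‖ * (cutoff ε t ‖x‖ * (expo γ * Real.exp (expo γ * (‖x‖ - ε))))
      + 2 * v x * (cutoff ε t ‖x‖ * Real.exp (expo γ * (‖x‖ - ε)))
      - v x * (expo γ * Real.exp (expo γ * (‖x‖ - ε)) *
        (Real.smoothTransition (t * (‖x‖ - ε) + 1) * deriv Real.smoothTransition (t + 1 - ‖x‖))))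
        ∂(m γ) := by
  set c := expo γ with hc
  -- Chosen so that `G(|x|) x = ψ² ∇f`: two powers of `r` come from `ψ²`, the third normalizes `x`.
  set G : ℝ → ℝ := fun r => c * (γ / (2 * Real.pi)) * Real.exp (c * (r - ε) - 2 * γ * r) / r ^ 3
    with hG
  have hGd : ∀ r, 0 < r → HasDerivAt G ((c - 2 * γ) * G r - 3 * G r / r) r := by
    intro r hr
    have h1 : HasDerivAt (fun r => c * (r - ε) - 2 * γ * r) (c - 2 * γ) r := by
      simpa using (((hasDerivAt_id r).sub_const ε).const_mul c).fun_sub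
        ((hasDerivAt_id r).const_mul (2 * γ))
    refine ((h1.exp.const_mul (c * (γ / (2 * Real.pi)))).div (hasDerivAt_pow 3 r)
      (pow_ne_zero 3 hr.ne')).congr_deriv ?_
    simp only [hG]
    field_simp
    push_cast
    ring
  set K : ℝ → ℝ := fun r => cutoff ε t r * G r with hK
  have hGs : ∀ r, 0 < r → ContDiffAt ℝ ∞ G r := by
    intro r hr
    refine ContDiffAt.div ?_ (contDiffAt_id.pow 3) (pow_ne_zero 3 hr.ne')
    fun_prop
  have hKs : ∀ r, 0 < r → ContDiffAt ℝ ∞ K r := fun r hr =>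
    (contDiff_cutoff ε t).contDiffAt.mul (hGs r hr)
  have ha : 0 < ε - 1 / t := by
    rw [sub_pos, div_lt_iff₀ ht]
    linarith
  have h0 : ∀ r < ε - 1 / t, K r = 0 := by
    intro r hr
    have : t * (r - ε) + 1 ≤ 0 := by
      have : t * r < t * (ε - 1 / t) := mul_lt_mul_of_pos_left hr ht
      rw [mul_sub, mul_one_div_cancel ht.ne'] at this
      linarith
    simp [hK, cutoff, Real.smoothTransition.zero_of_nonpos this]
  have h1 : ∀ r, t + 1 < r → K r = 0 := by
    intro r hr
    simp [hK, cutoff, Real.smoothTransition.zero_of_nonpos (by linarith : t + 1 - r ≤ 0)]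
  obtain ⟨i1, i2, h⟩ := hv.integral_radial hKs ha h0 h1
  -- A non-integrable integrand has integral `0` by convention, so that case is immediate.
  by_cases hint : Integrable (fun x => inner ℝ (g x) x / ‖x‖ *
        (cutoff ε t ‖x‖ * (c * Real.exp (c * (‖x‖ - ε))))
      + 2 * v x * (cutoff ε t ‖x‖ * Real.exp (c * (‖x‖ - ε)))
      - v x * (c * Real.exp (c * (‖x‖ - ε)) *
        (Real.smoothTransition (t * (‖x‖ - ε) + 1) * deriv Real.smoothTransition (t + 1 - ‖x‖))))
        (m γ)
  swap
  · rw [integral_undef hint]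
  have hsum : ∫ x, (v x * (‖x‖ * deriv K ‖x‖ + 3 * K ‖x‖) + inner ℝ (g x) x * K ‖x‖) = 0 := by
    rw [integral_add i1 i2, h, neg_add_cancel]
  rw [← hsum, integral_m]
  refine integral_mono_ae (i1.add i2) ?_ ?_
  · unfold m at hint
    rw [integrable_withDensity_iff_integrable_smul'
      ((measurable_psi γ).pow_const 2).ennreal_ofReal (by simp)] at hint
    simpa only [ENNReal.toReal_ofReal (sq_nonneg _), smul_eq_mul] using hint
  · filter_upwards [hpos, ae_ne_zero] with x hx hx0
    have hn : 0 < ‖x‖ := norm_pos_iff.2 hx0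
    have hKd := ((hasDerivAt_cutoff ε t ‖x‖).mul (hGd _ hn)).deriv
    have hKd' : deriv K ‖x‖ = _ := hKd
    rw [hKd', psi_sq hγ]
    have hexp : Real.exp (c * (‖x‖ - ε) - 2 * γ * ‖x‖)
        = Real.exp (c * (‖x‖ - ε)) * Real.exp (-2 * γ * ‖x‖) := by
      rw [← Real.exp_add]; congr 1; ring
    have hGx : G ‖x‖ = c * (γ / (2 * Real.pi)) *
        (Real.exp (c * (‖x‖ - ε)) * Real.exp (-2 * γ * ‖x‖)) / ‖x‖ ^ 3 := by
      rw [hG, ← hexp]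
    have hterm : 0 ≤ v x * (deriv Real.smoothTransition (t * (‖x‖ - ε) + 1)) := by
      rcases lt_or_ge ‖x‖ ε with hlt | hge
      · exact mul_nonneg (hx hlt) (Real.smoothTransition.monotone.deriv_nonneg)
      · rw [deriv_smoothTransition_eq_zero (.inr ?_), mul_zero]
        have := mul_nonneg ht.le (sub_nonneg.2 hge)
        linarith
    have hS := Real.smoothTransition.nonneg (t + 1 - ‖x‖)
    have hcneg : 0 < -c := neg_pos.2 (expo_neg γ)
    have hpi := Real.pi_pos
    have hfin : 0 ≤ (v x * (deriv Real.smoothTransition (t * (‖x‖ - ε) + 1))) *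
        (Real.smoothTransition (t + 1 - ‖x‖) * (t * (-c) * (γ / (2 * Real.pi)) *
          (Real.exp (c * (‖x‖ - ε)) * Real.exp (-2 * γ * ‖x‖)) / ‖x‖ ^ 2)) :=
      mul_nonneg hterm (by positivity)
    have hcc : c * (c - 2 * γ) = 2 := expo_mul_sub γ
    rw [← sub_nonneg]
    refine hfin.trans_eq ?_
    simp only [hK, cutoff, hGx]
    field_simp
    generalize Real.exp (c * (‖x‖ - ε)) = e1
    generalize Real.exp (-(2 * γ * ‖x‖)) = e2
    -- After cancellation only the characteristic equation `c (c - 2γ) = 2` is left to use.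
    linear_combination (v x * ‖x‖ * Real.smoothTransition (t + 1 - ‖x‖) *
      Real.smoothTransition (t * (‖x‖ - ε) + 1)) * hcc

open Filter Topology in
-- Dominated convergence applies because the term with the unbounded factor `t` has already been
-- dropped; the rest is controlled by `|g|` and `|v|`, integrable since `m` is finite. Off the null
-- sphere the integrand is eventually constant in `n`.
lemma tendsto_cutoff_integral {γ ε : ℝ} (hγ : 0 < γ)
    {v : R3 → ℝ} {g : R3 → R3} (hv : MemLp v 2 (m γ)) (hg : MemLp g 2 (m γ)) :
    Tendsto (fun n : ℕ => ∫ x, (inner ℝ (g x) x / ‖x‖ *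
        (cutoff ε n ‖x‖ * (expo γ * Real.exp (expo γ * (‖x‖ - ε))))
      + 2 * v x * (cutoff ε n ‖x‖ * Real.exp (expo γ * (‖x‖ - ε)))
      - v x * (expo γ * Real.exp (expo γ * (‖x‖ - ε)) *
        (Real.smoothTransition (n * (‖x‖ - ε) + 1) *
          deriv Real.smoothTransition (n + 1 - ‖x‖)))) ∂(m γ)) atTop
      (𝓝 (∫ x, {x : R3 | ε ≤ ‖x‖}.indicator (fun x =>
        inner ℝ (potentialGrad γ ε x) (g x) + 2 * (potential γ ε x * v x)) x ∂(m γ))) := by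
  have := isFiniteMeasure_m hγ
  obtain ⟨C, hC⟩ := exists_abs_deriv_smoothTransition_le
  set c := expo γ with hc
  have hcneg : c < 0 := expo_neg γ
  have hE : ∀ x : R3, Real.exp (c * (‖x‖ - ε)) ≤ Real.exp (-c * ε) := fun x => by
    rw [Real.exp_le_exp]
    have := mul_nonpos_of_nonpos_of_nonneg hcneg.le (norm_nonneg x)
    linarith
  have hgx : AEMeasurable (fun x => inner ℝ (g x) x / ‖x‖) (m γ) :=
    (hg.1.aemeasurable.inner aemeasurable_id).div measurable_norm.aemeasurable
  have hvm := hv.1.aemeasurable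
  have hvi := (hv.integrable (by norm_num)).norm
  have hgi := (hg.integrable (by norm_num)).norm
  refine tendsto_integral_of_dominated_convergence
    (fun x => ‖g x‖ * (1 * (|c| * Real.exp (-c * ε))) + 2 * ‖v x‖ * (1 * Real.exp (-c * ε))
      + ‖v x‖ * (|c| * Real.exp (-c * ε) * (1 * C))) (fun n => ?_) ?_ (fun n => ?_) ?_
  · have h1 : Continuous (cutoff ε n) := (contDiff_cutoff ε n).continuous
    have h2 := continuous_deriv_smoothTransition
    have a1 : Measurable fun x : R3 => cutoff ε n ‖x‖ * (c * Real.exp (c * (‖x‖ - ε))) := by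
      fun_prop
    have a2 : Measurable fun x : R3 => cutoff ε n ‖x‖ * Real.exp (c * (‖x‖ - ε)) := by
      fun_prop
    have a3 : Measurable fun x : R3 => c * Real.exp (c * (‖x‖ - ε)) *
        (Real.smoothTransition (n * (‖x‖ - ε) + 1) *
          deriv Real.smoothTransition (n + 1 - ‖x‖)) := by
      refine Continuous.measurable ?_
      fun_prop
    exact (((hgx.mul a1.aemeasurable).add ((hvm.const_mul 2).mul a2.aemeasurable)).sub
      (hvm.mul a3.aemeasurable)).aestronglyMeasurable
  · exact ((hgi.mul_const _).add ((hvi.const_mul 2).mul_const _)).add (hvi.mul_const _)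
  · refine .of_forall fun x => ?_
    have b1 : |cutoff ε n ‖x‖| ≤ 1 := by
      rw [abs_of_nonneg (cutoff_nonneg _ _ _)]
      exact cutoff_le_one _ _ _
    have b2 : |Real.smoothTransition (n * (‖x‖ - ε) + 1)| ≤ 1 := by
      rw [abs_of_nonneg (Real.smoothTransition.nonneg _)]
      exact Real.smoothTransition.le_one _
    have b3 : |inner ℝ (g x) x / ‖x‖| ≤ ‖g x‖ := by
      rw [abs_div, abs_norm]
      exact div_le_of_le_mul₀ (norm_nonneg _) (norm_nonneg _) (abs_real_inner_le_norm _ _)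
    rw [sub_eq_add_neg]
    refine (norm_add₃_le).trans ?_
    simp only [norm_neg, Real.norm_eq_abs, abs_mul, Real.abs_exp, Nat.abs_ofNat]
    have b4 := hC (n + 1 - ‖x‖)
    have b5 := hE x
    gcongr
  · have hS : ∀ᵐ x ∂(m γ), ‖x‖ ≠ ε := (m_absolutelyContinuous γ).ae_le (ae_norm_ne ε)
    filter_upwards [hS] with x hx
    refine tendsto_const_nhds.congr' ?_
    rcases lt_or_gt_of_ne hx with h | h
    · have h0 : 0 < ε - ‖x‖ := sub_pos.2 h
      filter_upwards [eventually_ge_atTop ⌈1 / (ε - ‖x‖)⌉₊] with n hn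
      have hn' : 1 / (ε - ‖x‖) ≤ n := Nat.ceil_le.1 hn
      rw [div_le_iff₀ h0] at hn'
      have hz : (n : ℝ) * (‖x‖ - ε) + 1 ≤ 0 := by linarith
      rw [indicator_of_notMem (by simpa using h)]
      simp [cutoff, Real.smoothTransition.zero_of_nonpos hz]
    · filter_upwards [eventually_ge_atTop ⌈‖x‖⌉₊] with n hn
      have hn' : ‖x‖ ≤ n := Nat.ceil_le.1 hn
      have h1 : 1 ≤ (n : ℝ) * (‖x‖ - ε) + 1 :=
        le_add_of_nonneg_left (mul_nonneg n.cast_nonneg (sub_nonneg.2 h.le))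
      have h2 : 1 ≤ (n : ℝ) + 1 - ‖x‖ := by linarith
      rw [indicator_of_mem (by exact h.le), deriv_smoothTransition_eq_zero (.inr h2)]
      simp only [cutoff, Real.smoothTransition.one_of_one_le h1,
        Real.smoothTransition.one_of_one_le h2, potentialGrad, potential, if_neg (not_le.2 h),
        indicator_of_mem (mem_Ioi.2 h), inner_smul_left, real_inner_comm x (g x)]
      simp
      ring

lemma energyOne_potential_nonneg {γ ε : ℝ} (hγ : 0 < γ) (hε : 0 < ε) {v : R3 → ℝ}
    (hv : v ∈ formDomain γ) (hpos : ∀ᵐ x ∂(m γ), ‖x‖ < ε → 0 ≤ v x) :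
    0 ≤ energyOne γ (potential γ ε) v := by
  have hf := potential_mem_formDomain hγ hε
  have hg := memLp_weakGradient hv
  have hpg : MemLp (potentialGrad γ ε) 2 (m γ) :=
    (memLp_weakGradient hf).ae_eq (weakGradient_potential γ hε)
  have i1 := MemLp.integrable_inner hpg hg
  have i2 : Integrable (fun x => 2 * (potential γ ε x * v x)) (m γ) :=
    (hf.1.integrable_mul hv.1).const_mul 2
  have hE : 2 * energyOne γ (potential γ ε) v = ∫ x, (inner ℝ (potentialGrad γ ε x)
      (weakGradient v x) + 2 * (potential γ ε x * v x)) ∂(m γ) := by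
    rw [integral_add i1 i2, integral_const_mul, energyOne, energy]
    have : ∫ x, inner ℝ (weakGradient (potential γ ε) x) (weakGradient v x) ∂(m γ)
        = ∫ x, inner ℝ (potentialGrad γ ε x) (weakGradient v x) ∂(m γ) := by
      refine integral_congr_ae ?_
      filter_upwards [weakGradient_potential γ hε] with x hx
      rw [hx]
    rw [this]
    ring
  have hms : MeasurableSet {x : R3 | ε ≤ ‖x‖} := measurableSet_le measurable_const measurable_norm
  have hlim := ge_of_tendsto (tendsto_cutoff_integral hγ hv.1 hg) (b := 0) (by
    filter_upwards [Filter.eventually_gt_atTop ⌈1 / ε⌉₊] with n hn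
    have hn' : 1 / ε < n := (Nat.le_ceil _).trans_lt (Nat.cast_lt.2 hn)
    exact cutoff_inequality hγ ((by positivity : (0 : ℝ) < 1 / ε).trans hn')
      ((div_lt_iff₀ hε).1 hn') (hasWeakGradient_weakGradient hv)
      ((volume_absolutelyContinuous_m hγ).ae_le hpos))
  have hle : ∫ x, {x : R3 | ε ≤ ‖x‖}.indicator (fun x =>
        inner ℝ (potentialGrad γ ε x) (weakGradient v x) + 2 * (potential γ ε x * v x)) x ∂(m γ)
      ≤ 2 * energyOne γ (potential γ ε) v := by
    rw [hE]
    -- Inside the ball the gradient vanishes and the potential is `1`, so the omitted integrand is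
    -- `2v ≥ 0`.
    refine integral_mono_ae ((i1.add i2).indicator hms) (i1.add i2) ?_
    filter_upwards [hpos] with x hx
    by_cases h : ε ≤ ‖x‖
    · rw [indicator_of_mem (by exact h)]
    · have h' := not_le.1 h
      rw [indicator_of_notMem (by exact h)]
      have := hx h'
      simpa [potentialGrad, potential, h'.le, h'] using this
  linarith

/-! ### The energy of the potential in closed form. -/

/-- The value of the capacity of the origin. -/
def originCap (γ : ℝ) : ℝ := (γ + γ * expo γ ^ 2 / 2) / (γ - expo γ)

lemma originCap_pos {γ : ℝ} (hγ : 0 < γ) : 0 < originCap γ := by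
  have := expo_neg γ
  refine div_pos (by positivity) (by linarith)

lemma originCap_le_one {γ : ℝ} (hγ : 0 < γ) : originCap γ ≤ 1 := by
  have h := expo_neg γ
  have h2 := expo_mul_sub γ
  refine (div_le_one (by linarith)).2 ?_
  -- After division by `-c > 0` the claim is `γ(-c) ≤ 2`, and `c² + 2γ(-c) = 2` gives even `γ(-c) ≤
  -- 1`.
  nlinarith [mul_pos hγ hγ, mul_pos hγ (neg_pos.2 h)]

lemma energyOne_potential {γ ε : ℝ} (hγ : 0 < γ) (hε : 0 < ε) :
    energyOne γ (potential γ ε) (potential γ ε)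
      = 1 - Real.exp (-2 * γ * ε) + Real.exp (-2 * γ * ε) * originCap γ := by
  set c := expo γ with hc
  have hcn : c < 0 := expo_neg γ
  have hf := potential_mem_formDomain hγ hε
  have hpg : MemLp (potentialGrad γ ε) 2 (m γ) :=
    (memLp_weakGradient hf).ae_eq (weakGradient_potential γ hε)
  have i1 := (MemLp.integrable_inner hpg hpg).const_mul (1 / 2)
  have i2 : Integrable (fun x => potential γ ε x * potential γ ε x) (m γ) :=
    hf.1.integrable_mul hf.1
  -- The radial profile of `½|∇f|² + f²`: it is `1` in the ball and `(1 + c²/2) e^{2c(r-ε)}`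
  -- outside.
  let F : ℝ → ℝ := fun r => 1 + (Ioi ε).indicator
    (fun r => (1 + c ^ 2 / 2) * Real.exp (2 * c * (r - ε)) - 1) r
  have e1 : energyOne γ (potential γ ε) (potential γ ε) = ∫ x, F ‖x‖ ∂(m γ) := by
    have : ∫ x, inner ℝ (weakGradient (potential γ ε) x) (weakGradient (potential γ ε) x) ∂(m γ)
        = ∫ x, inner ℝ (potentialGrad γ ε x) (potentialGrad γ ε x) ∂(m γ) := by
      refine integral_congr_ae ?_
      filter_upwards [weakGradient_potential γ hε] with x hx
      rw [hx]
    rw [energyOne, energy, this, ← integral_const_mul, ← integral_add i1 i2]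
    congr 1 with x
    rcases le_or_gt ‖x‖ ε with h | h
    · simp [F, potential, potentialGrad, h]
    · have hn : ‖x‖ ≠ 0 := (hε.trans h).ne'
      have hexp : Real.exp (2 * c * (‖x‖ - ε)) = Real.exp (c * (‖x‖ - ε)) ^ 2 := by
        rw [← Real.exp_nat_mul]
        congr 1
        push_cast
        ring
      simp only [F, potential, potentialGrad, if_neg (not_le.2 h), indicator_of_mem (mem_Ioi.2 h),
        inner_smul_left, inner_smul_right, real_inner_self_eq_norm_sq, hexp, ← hc]
      simp
      field_simp
      ring
  have hint : ∀ b : ℝ, IntegrableOn (fun r => Real.exp (-2 * γ * r)) (Ioi b) := fun b =>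
    integrableOn_exp_mul_Ioi (by linarith) b
  have hint2 : IntegrableOn (fun r => Real.exp ((2 * c - 2 * γ) * r)) (Ioi ε) :=
    integrableOn_exp_mul_Ioi (by linarith) ε
  have hfun : ∀ r, Real.exp (-2 * γ * r) * F r
      = Real.exp (-2 * γ * r) + (Ioi ε).indicator (fun r => (1 + c ^ 2 / 2) *
        Real.exp (-2 * c * ε) * Real.exp ((2 * c - 2 * γ) * r) - Real.exp (-2 * γ * r)) r := by
    intro r
    simp only [F]
    by_cases h : r ∈ Ioi ε
    · rw [indicator_of_mem h, indicator_of_mem h]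
      have : Real.exp (-2 * c * ε) * Real.exp ((2 * c - 2 * γ) * r)
          = Real.exp (2 * c * (r - ε)) * Real.exp (-2 * γ * r) := by
        rw [← Real.exp_add, ← Real.exp_add]
        congr 1
        ring
      linear_combination -(1 + c ^ 2 / 2) * this
    · rw [indicator_of_notMem h, indicator_of_notMem h]
      ring
  have hi3 : IntegrableOn (fun r => (1 + c ^ 2 / 2) * Real.exp (-2 * c * ε) *
      Real.exp ((2 * c - 2 * γ) * r) - Real.exp (-2 * γ * r)) (Ioi ε) :=
    (hint2.const_mul ((1 + c ^ 2 / 2) * Real.exp (-2 * c * ε))).sub (hint ε)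
  rw [e1, integral_norm_m hγ F]
  simp_rw [hfun]
  rw [integral_add (hint 0) (((integrable_indicator_iff measurableSet_Ioi).2 hi3).integrableOn),
    setIntegral_indicator measurableSet_Ioi, inter_eq_right.2 (Ioi_subset_Ioi hε.le),
    integral_sub (hint2.const_mul _) (hint ε), integral_const_mul,
    integral_exp_mul_Ioi (by linarith), integral_exp_mul_Ioi (by linarith),
    integral_exp_mul_Ioi (by linarith)]
  have hexp : Real.exp (-2 * c * ε) * Real.exp ((2 * c - 2 * γ) * ε) = Real.exp (-2 * γ * ε) := by
    rw [← Real.exp_add]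
    congr 1
    ring
  have h1 : (1 + c ^ 2 / 2) * Real.exp (-2 * c * ε) *
      (-Real.exp ((2 * c - 2 * γ) * ε) / (2 * c - 2 * γ))
      = (1 + c ^ 2 / 2) * Real.exp (-2 * γ * ε) / (2 * (γ - c)) := by
    have h3 : γ - c ≠ 0 := by linarith
    have h4 : 2 * c - 2 * γ = -(2 * (γ - c)) := by ring
    rw [← hexp, h4]
    field_simp
  rw [h1, originCap, ← hc]
  have h3 : γ - c ≠ 0 := by linarith
  simp only [mul_zero, Real.exp_zero]
  field_simp
  ring

/-- The energy is a convex combination of `1` and `originCap γ ≤ 1`. -/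
lemma originCap_le_energyOne_potential {γ ε : ℝ} (hγ : 0 < γ) (hε : 0 < ε) :
    originCap γ ≤ energyOne γ (potential γ ε) (potential γ ε) := by
  rw [energyOne_potential hγ hε]
  have h1 : Real.exp (-2 * γ * ε) ≤ 1 := Real.exp_le_one_iff.2 (by nlinarith [mul_pos hγ hε])
  nlinarith [originCap_le_one hγ]

/-! ### Capacity and equilibrium potential of balls. -/

lemma energyOne_self_nonneg (γ : ℝ) (u : R3 → ℝ) : 0 ≤ energyOne γ u u :=
  (integral_nonneg fun x => mul_self_nonneg (u x)).trans (integral_sq_le_energyOne γ u)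

lemma potential_mem_admissible {γ ε : ℝ} (hγ : 0 < γ) (hε : 0 < ε) :
    potential γ ε ∈ admissible γ (Metric.ball 0 ε) := by
  refine ⟨potential_mem_formDomain hγ hε, .of_forall fun x hx => ?_⟩
  rw [mem_ball_zero_iff] at hx
  exact (if_pos hx.le).ge

lemma energyOne_add_le {γ ε : ℝ} (hγ : 0 < γ) (hε : 0 < ε) {u : R3 → ℝ}
    (hu : u ∈ admissible γ (Metric.ball 0 ε)) :
    energyOne γ (potential γ ε) (potential γ ε)
      + energyOne γ (u - potential γ ε) (u - potential γ ε) ≤ energyOne γ u u := by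
  have hf := potential_mem_formDomain hγ hε
  rw [energyOne_eq_add hu.1 hf]
  have := energyOne_potential_nonneg hγ hε (sub_mem_formDomain hu.1 hf) (by
    filter_upwards [hu.2] with x hx h
    simpa [potential, h.le] using hx (by simpa using h))
  linarith

lemma openCap_ball {γ ε : ℝ} (hγ : 0 < γ) (hε : 0 < ε) :
    openCap γ (Metric.ball 0 ε)
      = ENNReal.ofReal (energyOne γ (potential γ ε) (potential γ ε)) := by
  refine le_antisymm (iInf₂_le _ (potential_mem_admissible hγ hε)) (le_iInf₂ fun u hu => ?_)
  refine ENNReal.ofReal_le_ofReal ?_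
  have := energyOne_add_le hγ hε hu
  have := energyOne_self_nonneg γ (u - potential γ ε)
  linarith

lemma openCap_mono (γ : ℝ) {A B : Set R3} (h : A ⊆ B) : openCap γ A ≤ openCap γ B :=
  biInf_mono fun _ hu => ⟨hu.1, hu.2.mono fun _ hx hxA => hx (h hxA)⟩

lemma cap_le_openCap (γ : ℝ) {A B : Set R3} (hB : IsOpen B) (h : A ⊆ B) :
    cap γ A ≤ openCap γ B :=
  iInf_le_of_le B (iInf₂_le hB h)

lemma cap_of_isOpen (γ : ℝ) {A : Set R3} (hA : IsOpen A) : cap γ A = openCap γ A :=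
  le_antisymm (cap_le_openCap γ hA Subset.rfl)
    (le_iInf fun _ => le_iInf₂ fun _ h => openCap_mono γ h)

lemma isEquilibriumPotential_potential {γ ε : ℝ} (hγ : 0 < γ) (hε : 0 < ε) :
    IsEquilibriumPotential γ (Metric.ball 0 ε) (potential γ ε) := by
  have hcap : ENNReal.ofReal (energyOne γ (potential γ ε) (potential γ ε))
      = cap γ (Metric.ball 0 ε) := by
    rw [cap_of_isOpen γ Metric.isOpen_ball, openCap_ball hγ hε]
  refine ⟨potential_mem_admissible hγ hε, hcap, fun u hu huc => ?_⟩
  rw [← hcap, ENNReal.ofReal_eq_ofReal_iff (energyOne_self_nonneg _ _)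
    (energyOne_self_nonneg _ _)] at huc
  have h1 := energyOne_add_le hγ hε hu
  have h2 := integral_sq_le_energyOne γ (u - potential γ ε)
  have hv : MemLp (u - potential γ ε) 2 (m γ) :=
    hu.1.1.sub (potential_mem_formDomain hγ hε).1
  -- Equal energies leave no room for `E₁(u - f, u - f)`, which dominates the squared `L²(m)` norm.
  have h3 : ∫ x, (u - potential γ ε) x * (u - potential γ ε) x ∂(m γ) = 0 :=
    le_antisymm (by linarith) (integral_nonneg fun x => mul_self_nonneg _)
  rw [integral_eq_zero_iff_of_nonneg (fun x => mul_self_nonneg _)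
    (by exact hv.integrable_mul hv)] at h3
  filter_upwards [h3] with x hx
  exact sub_eq_zero.1 (mul_self_eq_zero.1 hx)

/-! ### The origin: capacity and non-polarity. -/

lemma originCap_le_openCap {γ : ℝ} (hγ : 0 < γ) {B : Set R3} (hB : IsOpen B)
    (h0 : {0} ⊆ B) : ENNReal.ofReal (originCap γ) ≤ openCap γ B := by
  obtain ⟨ε, hε, h⟩ := Metric.isOpen_iff.1 hB 0 (h0 rfl)
  refine le_trans ?_ (openCap_mono γ h)
  rw [openCap_ball hγ hε]
  exact ENNReal.ofReal_le_ofReal (originCap_le_energyOne_potential hγ hε)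

open Filter Topology in
lemma cap_origin {γ : ℝ} (hγ : 0 < γ) : cap γ {0} = ENNReal.ofReal (originCap γ) := by
  refine le_antisymm ?_ (le_iInf fun B => le_iInf₂ fun hB h => originCap_le_openCap hγ hB h)
  have hlim : Tendsto (fun ε : ℝ => ENNReal.ofReal
      (1 - Real.exp (-2 * γ * ε) + Real.exp (-2 * γ * ε) * originCap γ)) (𝓝[>] 0)
      (𝓝 (ENNReal.ofReal (originCap γ))) := by
    have : Continuous fun ε : ℝ => ENNReal.ofReal
      (1 - Real.exp (-2 * γ * ε) + Real.exp (-2 * γ * ε) * originCap γ) :=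
      ENNReal.continuous_ofReal.comp (by fun_prop)
    have := (this.tendsto 0).mono_left (nhdsWithin_le_nhds (s := Ioi 0))
    simpa using this
  refine ge_of_tendsto hlim ?_
  filter_upwards [self_mem_nhdsWithin] with ε hε
  rw [← energyOne_potential hγ hε, ← openCap_ball hγ hε]
  exact cap_le_openCap γ Metric.isOpen_ball (by simpa using hε)

lemma not_isPolar_origin {γ : ℝ} (hγ : 0 < γ) : ¬ IsPolar γ {0} := by
  rintro ⟨K, ⟨hcl, -, hdense⟩, hK⟩
  have hf := potential_mem_formDomain hγ one_pos
  -- The unit-ball potential is approximated to within the capacity of the origin. Off `K n` and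
  -- inside the ball the error `potential γ 1 - v` equals `1`, so it is admissible for a
  -- neighbourhood of `0` and cannot be that small.
  obtain ⟨n, v, hv, hvan, hlt⟩ := hdense _ hf _ (originCap_pos hγ)
  have hopen : IsOpen ((K n)ᶜ ∩ Metric.ball (0 : R3) 1) :=
    (hcl n).isOpen_compl.inter Metric.isOpen_ball
  have h0 : {0} ⊆ (K n)ᶜ ∩ Metric.ball (0 : R3) 1 := by
    rintro x rfl
    exact ⟨mem_iInter.1 (hK rfl) n, by simp⟩
  have hadm : potential γ 1 - v ∈ admissible γ ((K n)ᶜ ∩ Metric.ball (0 : R3) 1) := by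
    refine ⟨sub_mem_formDomain hf hv, ?_⟩
    filter_upwards [hvan] with x hx h
    have h1 : ‖x‖ < 1 := by simpa using h.2
    simp [hx h.1, potential, h1.le]
  have := (originCap_le_openCap hγ hopen h0).trans (iInf₂_le _ hadm)
  rw [ENNReal.ofReal_le_ofReal_iff (energyOne_self_nonneg _ _)] at this
  exact absurd hlt (not_lt.2 this)

end DistortedBM

end

theorem proposition2 (γ : ℝ) (hγ : 0 < γ) :
    0 < DistortedBM.cap γ {0} ∧
    ¬ DistortedBM.IsPolar γ {0} ∧
    (∀ ε : ℝ, 0 < ε → DistortedBM.IsEquilibriumPotential γ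
      (Metric.ball (0 : DistortedBM.R3) ε) (DistortedBM.potential γ ε)) ∧
    DistortedBM.cap γ {0} = ENNReal.ofReal
      ((γ + γ * DistortedBM.expo γ ^ 2 / 2) / (γ - DistortedBM.expo γ)) := by
  refine ⟨?_, DistortedBM.not_isPolar_origin hγ,
    fun ε hε => DistortedBM.isEquilibriumPotential_potential hγ hε, DistortedBM.cap_origin hγ⟩
  rw [DistortedBM.cap_origin hγ]
  exact ENNReal.ofReal_pos.2 (DistortedBM.originCap_pos hγ)
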